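/- Let $M^n$ be a closed topological $n$-manifold (compact, without boundary, not necessarily connected) with a metric $d$ inducing its topology, and let $f^t$ $(t\in\mathbb R)$ be a topological flow on $M^n$. A point $x$ is chain recurrent if for every $\varepsilon>0$ there are $m\ge 1$, points $x=x_0,x_1,\dots,x_m=x$ and times $t_1,\dots,t_m\ge 1$ with $d(f^{t_i}(x_{i-1}),x_i)<\varepsilon$ for $1\le i\le m$; $\mathcal R_{f^t}$ denotes the set of chain recurrent points. For $\lambda\in\{0,\dots,n\}$ let $a^t_\lambda(x_1,\dots,x_n)=(2^tx_1,\dots,2^tx_\lambda,2^{-t}x_{\lambda+1},\dots,2^{-t}x_n)$, $E^s_\lambda=\{x\in\mathbb R^n: x_1=\dots=x_\lambda=0\}$ and $E^u_\lambda=\{x\in\mathbb R^n: x_{\lambda+1}=\dots=x_n=0\}$. A fixed point $p$ of $f^t$ is topologically hyperbolic of index $\lambda_p$ if there are an open neighborhood $U_p$ of $p$ and a homeomorphism $h_p$ of $U_p$ onto $\mathbb R^n$ with $h_p f^t=a^t_{\lambda_p}h_p$ wherever both sides are defined (that is, at every $x\in U_p$ with $f^t(x)\in U_p$); then put $$W^s_p=\bigcup_{t\in\mathbb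 R}f^t(h_p^{-1}(E^s_{\lambda_p})),\qquad W^u_p=\bigcup_{t\in\mathbb R}f^t(h_p^{-1}(E^u_{\lambda_p})).$$ Let $G(M^n)$ be the class of topological flows on $M^n$ whose chain recurrent set is finite and consists of topologically hyperbolic fixed points. **Theorem.** Let $f^t\in G(M^n)$, and for every $p\in\mathcal R_{f^t}$ let $\lambda_p$ and $h_p$ be as above. Write $p\prec q$ if $W^s_p\cap W^u_q\ne\emptyset$. Then $\mathcal R_{f^t}$ can be enumerated as $p_1,\dots,p_k$ so that $p_i\prec p_j$ implies $i\le j$, and so that, in addition, every sink ($\lambda_p=0$) precedes every saddle ($0<\lambda_p<n$) and every saddle precedes every source ($\lambda_p=n$). Moreover, for every enumeration $p_1,\dots,p_k$ of $\mathcal R_{f^t}$ such that $p_i\prec p_j$ implies $i\le j$: 1. $M^n=\bigcup_{i=1}^kW^u_{p_i}=\bigcup_{i=1}^kW^s_{p_i}$; 2. for every $i$, $W^u_{p_i}$ is a (locally flat) topological submanifold of $M^n$ which, with the subspace topology, is homeomorphic to $\mathbb R^{\lambda_{p_i}}$, and $W^s_{p_i}$ is a (locally flat) topological submanifold of $M^n$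 which, with the subspace topology, is homeomorphic to $\mathbb R^{n-\lambda_{p_i}}$; 3. for every $i$, $\operatorname{cl}(W^u_{p_i})\setminus(W^u_{p_i}\cup \{p_i\})\subset\bigcup_{j=1}^{i-1}W^u_{p_j}$ and $\operatorname{cl}(W^s_{p_i})\setminus(W^s_{p_i}\cup \{p_i\})\subset\bigcup_{j=i+1}^{k}W^s_{p_j}$. -/

import Mathlib

open Set

/-- An `ε`-chain of length `T` from `x` to `y` for the flow `f`: points `x = z 0, …, z m = y`
(`m ≥ 1`) and times `t i ≥ 1` with `dist (f^{t i} (z i)) (z (i+1)) < ε`, the sum of the times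
being `T`. -/
def IsEpsChain {M : Type*} [MetricSpace M] (f : Flow ℝ M) (ε T : ℝ) (x y : M) : Prop :=
  ∃ (m : ℕ) (z : ℕ → M) (t : ℕ → ℝ), 1 ≤ m ∧ z 0 = x ∧ z m = y ∧
    (∀ i < m, 1 ≤ t i ∧ dist (f (t i) (z i)) (z (i + 1)) < ε) ∧
    ∑ i ∈ Finset.range m, t i = T

/-- The chain recurrent set of a flow. -/
def chainRecurrentSet {M : Type*} [MetricSpace M] (f : Flow ℝ M) : Set M :=
  {x | ∀ ε : ℝ, 0 < ε → ∃ T : ℝ, IsEpsChain f ε T x x}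

/-- The model linear flow `a^t_l` on `ℝⁿ`: the first `l` coordinates are multiplied by `2 ^ t`,
the others by `2 ^ (-t)`. -/
noncomputable def modelFlow (n l : ℕ) (t : ℝ) (x : EuclideanSpace ℝ (Fin n)) :
    EuclideanSpace ℝ (Fin n) :=
  WithLp.toLp 2 fun i => if (i : ℕ) < l then (2 : ℝ) ^ t * x i else (2 : ℝ) ^ (-t) * x i

/-- The stable subspace `E^s_l` of the model flow: the first `l` coordinates vanish. -/
def modelStable (n l : ℕ) : Set (EuclideanSpace ℝ (Fin n)) :=
  {x | ∀ i : Fin n, (i : ℕ) < l → x i = 0}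

/-- The unstable subspace `E^u_l` of the model flow: all but the first `l` coordinates vanish. -/
def modelUnstable (n l : ℕ) : Set (EuclideanSpace ℝ (Fin n)) :=
  {x | ∀ i : Fin n, l ≤ (i : ℕ) → x i = 0}

/-- The data witnessing that `p` is a topologically hyperbolic fixed point of `f`: the index
`l ∈ {0, …, n}`, an open neighbourhood `U = chart.source` of `p` and a homeomorphism `chart` of
`U` onto `ℝⁿ` with `chart ∘ f^t = a^t_l ∘ chart` wherever both sides are defined. -/
structure HyperbolicChart (n : ℕ) {M : Type*} [MetricSpace M] (f : Flow ℝ M) (p : M) where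
  isFixed : ∀ t : ℝ, f t p = p
  index : ℕ
  index_le : index ≤ n
  chart : OpenPartialHomeomorph M (EuclideanSpace ℝ (Fin n))
  mem_source : p ∈ chart.source
  target_eq : chart.target = univ
  conj : ∀ (t : ℝ) (x : M), x ∈ chart.source → f t x ∈ chart.source →
    chart (f t x) = modelFlow n index t (chart x)

/-- The stable invariant manifold: the union over all `t` of `f^t (h⁻¹ (E^s))`. -/
def HyperbolicChart.stable {n : ℕ} {M : Type*} [MetricSpace M] {f : Flow ℝ M} {p : M}
    (h : HyperbolicChart n f p) : Set M :=
  ⋃ t : ℝ, f t '' (h.chart.source ∩ h.chart ⁻¹' modelStable n h.index)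

/-- The unstable invariant manifold: the union over all `t` of `f^t (h⁻¹ (E^u))`. -/
def HyperbolicChart.unstable {n : ℕ} {M : Type*} [MetricSpace M] {f : Flow ℝ M} {p : M}
    (h : HyperbolicChart n f p) : Set M :=
  ⋃ t : ℝ, f t '' (h.chart.source ∩ h.chart ⁻¹' modelUnstable n h.index)

/-- A sink: index `0`. -/
def HyperbolicChart.IsSink {n : ℕ} {M : Type*} [MetricSpace M] {f : Flow ℝ M} {p : M}
    (h : HyperbolicChart n f p) : Prop := h.index = 0

/-- A source: index `n`. -/
def HyperbolicChart.IsSource {n : ℕ} {M : Type*} [MetricSpace M] {f : Flow ℝ M} {p : M}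
    (h : HyperbolicChart n f p) : Prop := h.index = n

/-- A saddle: index in `{1, …, n - 1}`. -/
def HyperbolicChart.IsSaddle {n : ℕ} {M : Type*} [MetricSpace M] {f : Flow ℝ M} {p : M}
    (h : HyperbolicChart n f p) : Prop := 0 < h.index ∧ h.index < n

/-- The class `G(Mⁿ)`: the chain recurrent set is finite and consists of topologically hyperbolic
fixed points. -/
def IsClassG (n : ℕ) {M : Type*} [MetricSpace M] (f : Flow ℝ M) : Prop :=
  (chainRecurrentSet f).Finite ∧ ∀ p ∈ chainRecurrentSet f, Nonempty (HyperbolicChart n f p)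

/-- The enumeration `p 0, …, p (k-1)` of the chain recurrent set is a total order extending the
relation `p ≺ q ↔ W^s_p ∩ W^u_q ≠ ∅`. -/
def ExtendsSmaleRelation {n : ℕ} {M : Type*} [MetricSpace M] {f : Flow ℝ M}
    (h : ∀ p : chainRecurrentSet f, HyperbolicChart n f (p : M)) {k : ℕ}
    (p : Fin k ≃ chainRecurrentSet f) : Prop :=
  ∀ i j : Fin k, ((h (p i)).stable ∩ (h (p j)).unstable).Nonempty → i ≤ j

/-- In the enumeration every sink precedes every saddle and every saddle precedes every source. -/
def SinksSaddlesSources {n : ℕ} {M : Type*} [MetricSpace M] {f : Flow ℝ M}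
    (h : ∀ p : chainRecurrentSet f, HyperbolicChart n f (p : M)) {k : ℕ}
    (p : Fin k ≃ chainRecurrentSet f) : Prop :=
  (∀ i j : Fin k, (h (p i)).IsSink → (h (p j)).IsSaddle → i < j) ∧
  (∀ i j : Fin k, (h (p i)).IsSaddle → (h (p j)).IsSource → i < j)

/-- `A` is a `d`-dimensional (locally flat) topological submanifold of the `n`-manifold `M`:
around each of its points there is a chart of `M` that takes `A` to the coordinate plane
`ℝᵈ ⊆ ℝⁿ`. -/
def IsTopSubmanifold (n d : ℕ) {M : Type*} [TopologicalSpace M] (A : Set M) : Prop :=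
  d ≤ n ∧ ∀ a ∈ A, ∃ e : OpenPartialHomeomorph M (EuclideanSpace ℝ (Fin n)),
    a ∈ e.source ∧ e '' (e.source ∩ A) = e.target ∩ {x | ∀ i : Fin n, d ≤ (i : ℕ) → x i = 0}

/-!
The domain `U` of a hyperbolic chart at `p` is invariant under the flow: the conjugacy holds
wherever it makes sense, and the model flow on `ℝⁿ` is complete
(`HyperbolicChart.flow_mem_source`). Hence the stable and unstable manifolds of `p` are simply the
preimages of the coordinate planes `E^s` and `E^u` under the chart, which settles their
submanifold structure, and they are characterized by convergence of orbits to `p` in forward and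
backward time (`HyperbolicChart.mem_stable_iff_tendsto`). Statements about stable manifolds are
obtained from those about unstable ones by reversing time (`HyperbolicChart.reverse`).

Limit points of orbits in forward and backward time are chain recurrent. As there are finitely many
of them, every orbit converges in both directions, so the stable manifolds cover `M`, and so do the
unstable ones.

If `p ≺ q`, then `p` is reached from `q` by `ε`-chains for all `ε`. A cycle of `≺` would therefore
consist of chain recurrent points, and these are fixed (`SmaleRel.eq_of_chainReaches`); so `≺`
generates a partial order. It is compatible with the division into sinks, saddles and sources
because a sink equals its unstable manifold and a source its stable one. A linear extension of the
resulting lexicographic order is the required enumeration.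

For the closures, suppose that `W^u_p` accumulates on a fixed point `q ≠ p`. Following points of
`W^u_p` near `q` backward until they leave the neighbourhood of `q`, one finds a point `y ≠ q` of
`W^s_q` in the closure of `W^u_p` (`HyperbolicChart.exists_mem_closure_mem_stable`). It lies in
`W^u_q'` for some `q'`, and `q'` strictly follows `q` because the stable and unstable manifolds of
`q` meet only in `q`. Now `W^u_p` accumulates on `q'` as well. The enumeration is finite, so the
process ends, and it can only end at `p`; thus `q` precedes `p` (`le_of_mem_closure_unstable`).
-/

open Filter Topology

section

variable {n : ℕ} {M : Type*} [MetricSpace M]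

/-! ### The linear model -/

theorem modelFlow_apply (l : ℕ) (t : ℝ) (x : EuclideanSpace ℝ (Fin n)) (i : Fin n) :
    modelFlow n l t x i = if (i : ℕ) < l then (2 : ℝ) ^ t * x i else (2 : ℝ) ^ (-t) * x i := rfl

theorem continuous_modelFlow_time (l : ℕ) (x : EuclideanSpace ℝ (Fin n)) :
    Continuous fun t : ℝ => modelFlow n l t x := by
  refine (PiLp.continuous_toLp 2 _).comp (continuous_pi fun i => ?_)
  have h2 : (2 : ℝ) ≠ 0 := two_ne_zero
  split_ifs
  · exact (Real.continuous_const_rpow h2).mul continuous_const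
  · exact ((Real.continuous_const_rpow h2).comp continuous_neg).mul continuous_const

theorem modelFlow_mem_modelStable {l : ℕ} {x : EuclideanSpace ℝ (Fin n)}
    (hx : x ∈ modelStable n l) (t : ℝ) : modelFlow n l t x ∈ modelStable n l := by
  intro i hi
  simp [modelFlow_apply, hi, hx i hi]

theorem modelFlow_mem_modelUnstable {l : ℕ} {x : EuclideanSpace ℝ (Fin n)}
    (hx : x ∈ modelUnstable n l) (t : ℝ) : modelFlow n l t x ∈ modelUnstable n l := by
  intro i hi
  simp [modelFlow_apply, hx i hi]

theorem tendsto_two_rpow_neg_atTop : Tendsto (fun t : ℝ => (2 : ℝ) ^ (-t)) atTop (𝓝 0) :=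
  (tendsto_rpow_atBot_of_base_gt_one 2 one_lt_two).comp tendsto_neg_atTop_atBot

theorem tendsto_modelFlow_of_mem_modelStable {l : ℕ} {x : EuclideanSpace ℝ (Fin n)}
    (hx : x ∈ modelStable n l) : Tendsto (fun t : ℝ => modelFlow n l t x) atTop (𝓝 0) := by
  have h : Tendsto (fun t : ℝ => (2 : ℝ) ^ (-t) • x) atTop (𝓝 ((0 : ℝ) • x)) :=
    tendsto_two_rpow_neg_atTop.smul_const x
  rw [zero_smul] at h
  refine h.congr fun t => ?_
  ext i
  by_cases hi : (i : ℕ) < l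
  · simp [modelFlow_apply, hi, hx i hi]
  · simp [modelFlow_apply, hi]

theorem mem_modelStable_of_tendsto {l : ℕ} {x y : EuclideanSpace ℝ (Fin n)}
    (hx : Tendsto (fun t : ℝ => modelFlow n l t x) atTop (𝓝 y)) : x ∈ modelStable n l := by
  intro i hi
  -- The coordinate is `2 ^ (-t) * (2 ^ t * x i)`, and the second factor converges.
  have h1 : Tendsto (fun t : ℝ => modelFlow n l t x i) atTop (𝓝 (y i)) :=
    ((PiLp.continuous_apply 2 _ i).tendsto y).comp hx
  have h2 := tendsto_two_rpow_neg_atTop.mul h1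
  rw [zero_mul] at h2
  refine tendsto_nhds_unique (tendsto_const_nhds.congr fun t => ?_) h2
  have := (Real.rpow_pos_of_pos (two_pos (α := ℝ)) t).ne'
  simp only [modelFlow_apply, hi, if_true, Real.rpow_neg two_pos.le]
  field_simp

/-! ### Charts are invariant under the flow -/

theorem Flow.apply_neg_apply (f : Flow ℝ M) (t : ℝ) (x : M) : f (-t) (f t x) = x := by
  rw [← Flow.map_add, neg_add_cancel, Flow.map_zero_apply]

theorem Flow.apply_apply_neg (f : Flow ℝ M) (t : ℝ) (x : M) : f t (f (-t) x) = x := by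
  rw [← Flow.map_add, add_neg_cancel, Flow.map_zero_apply]

namespace HyperbolicChart

variable {f : Flow ℝ M} {p q : M}

theorem symm_mem_source (h : HyperbolicChart n f p) (v : EuclideanSpace ℝ (Fin n)) :
    h.chart.symm v ∈ h.chart.source :=
  h.chart.map_target (by simp [h.target_eq])

theorem chart_symm (h : HyperbolicChart n f p) (v : EuclideanSpace ℝ (Fin n)) :
    h.chart (h.chart.symm v) = v :=
  h.chart.right_inv (by simp [h.target_eq])

theorem continuous_symm (h : HyperbolicChart n f p) : Continuous h.chart.symm := by
  rw [← continuousOn_univ, ← h.target_eq]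
  exact h.chart.continuousOn_symm

/-- The domain of a chart is invariant. The model flow is complete on `ℝⁿ`, so the times at which
an orbit starting in the domain lies in the domain are also the times at which it agrees with the
transported model orbit; this set of times is open by the first description and closed by the
second. -/
theorem flow_mem_source (h : HyperbolicChart n f p) {x : M} (hx : x ∈ h.chart.source) (t : ℝ) :
    f t x ∈ h.chart.source := by
  have hc : Continuous fun t : ℝ => f t x := f.continuous continuous_id continuous_const
  have key : {t : ℝ | f t x ∈ h.chart.source} =
      {t : ℝ | f t x = h.chart.symm (modelFlow n h.index t (h.chart x))} := by
    ext t
    constructor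
    · intro ht
      change f t x = _
      rw [← h.conj t x hx ht, h.chart.left_inv ht]
    · intro ht
      change f t x ∈ h.chart.source
      rw [show f t x = _ from ht]
      exact h.symm_mem_source _
  have hcl : IsClopen {t : ℝ | f t x ∈ h.chart.source} := by
    constructor
    · rw [key]
      exact isClosed_eq hc (h.continuous_symm.comp (continuous_modelFlow_time _ _))
    · exact h.chart.open_source.preimage hc
  have := hcl.eq_univ ⟨0, by simpa [Flow.map_zero_apply] using hx⟩
  exact (this ▸ mem_univ t : t ∈ {t : ℝ | f t x ∈ h.chart.source})

theorem mem_source_of_flow_mem (h : HyperbolicChart n f p) {x : M} {t : ℝ}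
    (hx : f t x ∈ h.chart.source) : x ∈ h.chart.source := by
  simpa [Flow.apply_neg_apply] using h.flow_mem_source hx (-t)

theorem chart_flow (h : HyperbolicChart n f p) {x : M} (hx : x ∈ h.chart.source) (t : ℝ) :
    h.chart (f t x) = modelFlow n h.index t (h.chart x) :=
  h.conj t x hx (h.flow_mem_source hx t)

theorem iUnion_image_eq (h : HyperbolicChart n f p) {E : Set (EuclideanSpace ℝ (Fin n))}
    (hE : ∀ v ∈ E, ∀ t, modelFlow n h.index t v ∈ E) :
    ⋃ t : ℝ, f t '' (h.chart.source ∩ h.chart ⁻¹' E) = h.chart.source ∩ h.chart ⁻¹' E := by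
  apply Subset.antisymm
  · refine iUnion_subset fun t => ?_
    rintro _ ⟨x, ⟨hx, hxE⟩, rfl⟩
    refine ⟨h.flow_mem_source hx t, ?_⟩
    rw [mem_preimage, h.chart_flow hx]
    exact hE _ hxE t
  · intro x hx
    exact mem_iUnion.2 ⟨0, x, hx, f.map_zero_apply x⟩

theorem stable_eq (h : HyperbolicChart n f p) :
    h.stable = h.chart.source ∩ h.chart ⁻¹' modelStable n h.index :=
  h.iUnion_image_eq fun _ hv t => modelFlow_mem_modelStable hv t

theorem unstable_eq (h : HyperbolicChart n f p) :
    h.unstable = h.chart.source ∩ h.chart ⁻¹' modelUnstable n h.index :=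
  h.iUnion_image_eq fun _ hv t => modelFlow_mem_modelUnstable hv t

theorem chart_self (h : HyperbolicChart n f p) : h.chart p = 0 := by
  have h1 := h.chart_flow h.mem_source 1
  rw [h.isFixed] at h1
  ext i
  have h2 := congrArg (fun v : EuclideanSpace ℝ (Fin n) => v i) h1
  simp only [modelFlow_apply, Real.rpow_neg two_pos.le, Real.rpow_one] at h2
  simp only [PiLp.zero_apply]
  split_ifs at h2 <;> linarith

theorem symm_zero (h : HyperbolicChart n f p) : h.chart.symm 0 = p := by
  rw [← h.chart_self, h.chart.left_inv h.mem_source]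

theorem mem_stable_iff_tendsto (h : HyperbolicChart n f p) {x : M} :
    x ∈ h.stable ↔ Tendsto (fun t => f t x) atTop (𝓝 p) := by
  rw [h.stable_eq]
  constructor
  · rintro ⟨hx, hxE⟩
    have h1 := (h.continuous_symm.tendsto 0).comp (tendsto_modelFlow_of_mem_modelStable hxE)
    rw [h.symm_zero] at h1
    refine h1.congr fun t => ?_
    rw [Function.comp_apply, ← h.chart_flow hx, h.chart.left_inv (h.flow_mem_source hx t)]
  · intro hx
    obtain ⟨t, ht⟩ := (hx.eventually (h.chart.open_source.mem_nhds h.mem_source)).exists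
    have hxs := h.mem_source_of_flow_mem ht
    refine ⟨hxs, mem_modelStable_of_tendsto (y := h.chart p) ?_⟩
    refine ((h.chart.continuousAt h.mem_source).tendsto.comp hx).congr fun t => ?_
    exact h.chart_flow hxs t

/-! ### Time reversal -/

/-- The linear isometry of `ℝⁿ` that reverses the order of the coordinates. -/
noncomputable def revCoords (n : ℕ) :
    EuclideanSpace ℝ (Fin n) ≃ₗᵢ[ℝ] EuclideanSpace ℝ (Fin n) :=
  LinearIsometryEquiv.piLpCongrLeft 2 ℝ ℝ Fin.revPerm

/-- A hyperbolic chart for the time-reversed flow at the same point: its index is `n - index`, and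
the coordinates are taken in the reverse order, so that the expanding ones again come first. -/
noncomputable def reverse (h : HyperbolicChart n f p) : HyperbolicChart n f.reverse p where
  isFixed t := h.isFixed (-t)
  index := n - h.index
  index_le := Nat.sub_le _ _
  chart := h.chart.transHomeomorph (revCoords n).toHomeomorph
  mem_source := h.mem_source
  target_eq := by simp [h.target_eq]
  conj t x hx _ := by
    ext i
    have := h.index_le
    change h.chart (f (-t) x) i.rev = if (i : ℕ) < n - h.index then
      (2 : ℝ) ^ t * h.chart x i.rev else (2 : ℝ) ^ (-t) * h.chart x i.rev
    rw [h.chart_flow hx, modelFlow_apply, Fin.val_rev, neg_neg]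
    have := i.2
    split_ifs <;> first | rfl | omega

theorem reverse_stable (h : HyperbolicChart n f p) : h.reverse.stable = h.unstable := by
  rw [stable_eq, unstable_eq]
  ext x
  refine and_congr Iff.rfl ?_
  have hl := h.index_le
  constructor
  · intro hx i hi
    have := hx i.rev (by simp only [reverse, Fin.val_rev]; omega)
    change h.chart x i.rev.rev = 0 at this
    rwa [Fin.rev_rev] at this
  · intro hx i hi
    exact hx i.rev (by simp only [reverse] at hi; simp only [Fin.val_rev]; omega)

theorem reverse_unstable (h : HyperbolicChart n f p) : h.reverse.unstable = h.stable := by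
  rw [stable_eq, unstable_eq]
  ext x
  refine and_congr Iff.rfl ?_
  have hl := h.index_le
  constructor
  · intro hx i hi
    have := hx i.rev (by simp only [reverse, Fin.val_rev]; omega)
    change h.chart x i.rev.rev = 0 at this
    rwa [Fin.rev_rev] at this
  · intro hx i hi
    exact hx i.rev (by simp only [reverse] at hi; simp only [Fin.val_rev]; omega)

theorem mem_unstable_iff_tendsto (h : HyperbolicChart n f p) {x : M} :
    x ∈ h.unstable ↔ Tendsto (fun t => f (-t) x) atTop (𝓝 p) := by
  rw [← h.reverse_stable, mem_stable_iff_tendsto]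
  rfl

/-! ### Invariant manifolds as submanifolds -/

theorem isTopSubmanifold_unstable (h : HyperbolicChart n f p) :
    IsTopSubmanifold n h.index h.unstable := by
  refine ⟨h.index_le, fun a ha => ⟨h.chart, ?_, ?_⟩⟩
  · rw [h.unstable_eq] at ha
    exact ha.1
  · rw [h.unstable_eq, ← inter_assoc, inter_self, ← h.chart.image_source_eq_target,
      image_inter_preimage]
    rfl

/-- The coordinate plane `E^u_l` is homeomorphic to `ℝˡ`. -/
noncomputable def modelUnstableHomeomorph {l : ℕ} (hl : l ≤ n) :
    modelUnstable n l ≃ₜ EuclideanSpace ℝ (Fin l) where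
  toFun x := WithLp.toLp 2 fun i => x.1 (Fin.castLE hl i)
  invFun y := ⟨WithLp.toLp 2 fun i => if hi : (i : ℕ) < l then y ⟨i, hi⟩ else 0,
    fun i hi => dif_neg (not_lt.2 hi)⟩
  left_inv x := by
    ext i
    by_cases hi : (i : ℕ) < l
    · simp [hi]
    · simp [hi, x.2 i (not_lt.1 hi)]
  right_inv y := by
    ext i
    simp
  continuous_toFun := by fun_prop
  continuous_invFun := by
    refine Continuous.subtype_mk ((PiLp.continuous_toLp 2 _).comp (continuous_pi fun i => ?_)) _
    split_ifs <;> fun_prop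

/-- The chart restricts to a homeomorphism of the unstable manifold onto `E^u`. -/
noncomputable def unstableHomeomorph (h : HyperbolicChart n f p) :
    h.unstable ≃ₜ modelUnstable n h.index where
  toFun x := ⟨h.chart x, (h.unstable_eq.subset x.2).2⟩
  invFun v := ⟨h.chart.symm v, h.unstable_eq.superset
    ⟨h.symm_mem_source _, by rw [mem_preimage, h.chart_symm]; exact v.2⟩⟩
  left_inv x := Subtype.ext (h.chart.left_inv (h.unstable_eq.subset x.2).1)
  right_inv v := Subtype.ext (h.chart_symm _)
  continuous_toFun := Continuous.subtype_mk
    (h.chart.continuousOn.comp_continuous continuous_subtype_val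
      fun x => (h.unstable_eq.subset x.2).1) _
  continuous_invFun := Continuous.subtype_mk (h.continuous_symm.comp continuous_subtype_val) _

theorem nonempty_unstable_homeomorph (h : HyperbolicChart n f p) :
    Nonempty (h.unstable ≃ₜ EuclideanSpace ℝ (Fin h.index)) :=
  ⟨h.unstableHomeomorph.trans (modelUnstableHomeomorph h.index_le)⟩

theorem isTopSubmanifold_stable (h : HyperbolicChart n f p) :
    IsTopSubmanifold n (n - h.index) h.stable := by
  rw [← h.reverse_unstable]
  exact h.reverse.isTopSubmanifold_unstable

theorem nonempty_stable_homeomorph (h : HyperbolicChart n f p) :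
    Nonempty (h.stable ≃ₜ EuclideanSpace ℝ (Fin (n - h.index))) := by
  rw [← h.reverse_unstable]
  exact h.reverse.nonempty_unstable_homeomorph

/-! ### Position of the invariant manifolds -/

theorem stable_inter_unstable (h : HyperbolicChart n f p) : h.stable ∩ h.unstable = {p} := by
  rw [h.stable_eq, h.unstable_eq]
  ext x
  constructor
  · rintro ⟨⟨hx, hs⟩, -, hu⟩
    have h0 : h.chart x = 0 := by
      ext i
      rcases lt_or_ge (i : ℕ) h.index with hi | hi
      exacts [hs i hi, hu i hi]
    rw [mem_singleton_iff, ← h.chart.left_inv hx, h0, h.symm_zero]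
  · rintro rfl
    refine ⟨⟨h.mem_source, fun i _ => ?_⟩, h.mem_source, fun i _ => ?_⟩ <;> simp [h.chart_self]

theorem self_mem_stable (h : HyperbolicChart n f p) : p ∈ h.stable :=
  (h.stable_inter_unstable.superset rfl).1

theorem self_mem_unstable (h : HyperbolicChart n f p) : p ∈ h.unstable :=
  (h.stable_inter_unstable.superset rfl).2

theorem eq_of_mem_stable (h : HyperbolicChart n f p) (h' : HyperbolicChart n f q) {x : M}
    (hx : x ∈ h.stable) (hx' : x ∈ h'.stable) : p = q :=
  tendsto_nhds_unique (h.mem_stable_iff_tendsto.1 hx) (h'.mem_stable_iff_tendsto.1 hx')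

theorem eq_of_mem_unstable (h : HyperbolicChart n f p) (h' : HyperbolicChart n f q) {x : M}
    (hx : x ∈ h.unstable) (hx' : x ∈ h'.unstable) : p = q :=
  tendsto_nhds_unique (h.mem_unstable_iff_tendsto.1 hx) (h'.mem_unstable_iff_tendsto.1 hx')

theorem unstable_eq_singleton (h : HyperbolicChart n f p) (h0 : h.index = 0) :
    h.unstable = {p} := by
  rw [← h.stable_inter_unstable, eq_comm, inter_eq_right, h.stable_eq, h.unstable_eq]
  exact fun x hx => ⟨hx.1, fun i hi => by omega⟩

theorem stable_eq_singleton (h : HyperbolicChart n f p) (hn : h.index = n) :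
    h.stable = {p} := by
  rw [← h.reverse_unstable]
  exact h.reverse.unstable_eq_singleton (by simp [reverse, hn])

theorem flow_mem_unstable (h : HyperbolicChart n f p) {x : M} (hx : x ∈ h.unstable) (t : ℝ) :
    f t x ∈ h.unstable := by
  rw [h.unstable_eq] at hx ⊢
  refine ⟨h.flow_mem_source hx.1 t, ?_⟩
  rw [mem_preimage, h.chart_flow hx.1]
  exact modelFlow_mem_modelUnstable hx.2 t

/-! ### Closures of unstable manifolds -/

/-- The projection of `ℝⁿ` onto `E^s_l` along `E^u_l`. -/
noncomputable def stableProj (n l : ℕ) (v : EuclideanSpace ℝ (Fin n)) :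
    EuclideanSpace ℝ (Fin n) :=
  WithLp.toLp 2 fun i => if (i : ℕ) < l then 0 else v i

theorem stableProj_apply (l : ℕ) (v : EuclideanSpace ℝ (Fin n)) (i : Fin n) :
    stableProj n l v i = if (i : ℕ) < l then 0 else v i := rfl

theorem continuous_stableProj (l : ℕ) : Continuous (stableProj n l) := by
  refine (PiLp.continuous_toLp 2 _).comp (continuous_pi fun i => ?_)
  split_ifs <;> fun_prop

theorem isClosed_modelStable (l : ℕ) : IsClosed (modelStable n l) := by
  have : modelStable n l = {v | stableProj n l v = v} := by
    ext v
    constructor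
    · intro hv
      ext i
      by_cases hi : (i : ℕ) < l
      · simp [stableProj_apply, hi, hv i hi]
      · simp [stableProj_apply, hi]
    · intro hv i hi
      rw [← (show stableProj n l v = v from hv), stableProj_apply, if_pos hi]
  rw [this]
  exact isClosed_eq (continuous_stableProj l) continuous_id

/-- The backward passage near a saddle: if the invariant set `A` accumulates on `q` but misses the
unstable manifold of `q`, then its closure contains a point of the stable manifold other than `q`.

In the chart, a point `u + s` of `A` with `u ∈ E^u` and `s ∈ E^s` small has `s ≠ 0`, and the flow
at the time `log₂ ‖s‖` takes it to `‖s‖ u + s / ‖s‖`. As the point tends to `q`, the first summand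
tends to `0` and the second one stays in the compact unit sphere of `E^s`. -/
theorem exists_mem_closure_mem_stable (h : HyperbolicChart n f q) {A : Set M}
    (hA : ∀ x ∈ A, ∀ t, f t x ∈ A) (hq : q ∈ closure A) (hd : Disjoint A h.unstable) :
    ∃ y ∈ closure A, y ∈ h.stable ∧ y ≠ q := by
  set l := h.index
  have : (𝓝[A] q).NeBot := mem_closure_iff_nhdsWithin_neBot.1 hq
  set F := Ultrafilter.of (𝓝[A] q)
  have hF : (F : Filter M) ≤ 𝓝[A] q := Ultrafilter.of_le _
  have hFq : (F : Filter M) ≤ 𝓝 q := hF.trans nhdsWithin_le_nhds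
  have hFA : ∀ᶠ x in (F : Filter M), x ∈ A := hF self_mem_nhdsWithin
  have hFU : ∀ᶠ x in (F : Filter M), x ∈ h.chart.source :=
    hFq (h.chart.open_source.mem_nhds h.mem_source)
  let s : M → EuclideanSpace ℝ (Fin n) := fun x => stableProj n l (h.chart x)
  have hlim : Tendsto (fun x => h.chart x) F (𝓝 0) := by
    have := (h.chart.continuousAt h.mem_source).tendsto
    rw [h.chart_self] at this
    exact this.mono_left hFq
  have hs0 : Tendsto s F (𝓝 0) := by
    have h1 := (continuous_stableProj (n := n) l).tendsto 0
    have h2 : stableProj n l (0 : EuclideanSpace ℝ (Fin n)) = 0 := by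
      ext i; simp [stableProj_apply]
    rw [h2] at h1
    exact h1.comp hlim
  have hspos : ∀ᶠ x in (F : Filter M), 0 < ‖s x‖ := by
    filter_upwards [hFA, hFU] with x hxA hxU
    rw [norm_pos_iff]
    intro hx0
    refine disjoint_left.1 hd hxA (h.unstable_eq.superset ⟨hxU, fun i hi => ?_⟩)
    have : stableProj n l (h.chart x) i = 0 :=
      congrArg (fun v : EuclideanSpace ℝ (Fin n) => v i) hx0
    rw [stableProj_apply, if_neg (not_lt.2 hi)] at this
    exact this
  let e : M → EuclideanSpace ℝ (Fin n) := fun x => ‖s x‖⁻¹ • s x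
  have hsphere : ∀ᶠ x in (F : Filter M), e x ∈ Metric.sphere (0 : EuclideanSpace ℝ (Fin n)) 1 := by
    filter_upwards [hspos] with x hx
    rw [mem_sphere_zero_iff_norm, norm_smul, norm_inv, norm_norm, inv_mul_cancel₀ hx.ne']
  obtain ⟨w, hw1, hw⟩ := (isCompact_sphere (0 : EuclideanSpace ℝ (Fin n)) 1).ultrafilter_le_nhds'
    (F.map e) hsphere
  have hew : Tendsto e F (𝓝 w) := hw
  have hws : w ∈ modelStable n l := by
    refine (isClosed_modelStable l).mem_of_tendsto hew (Eventually.of_forall fun x i hi => ?_)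
    simp [e, s, stableProj_apply, hi]
  have hflow : Tendsto (fun x => f (Real.logb 2 ‖s x‖) x) F (𝓝 (h.chart.symm w)) := by
    have h1 : Tendsto (fun x => ‖s x‖ • (h.chart x - s x) + e x) F (𝓝 w) := by
      simpa using ((hs0.norm).smul (hlim.sub hs0)).add hew
    refine ((h.continuous_symm.tendsto w).comp h1).congr' ?_
    filter_upwards [hFU, hspos] with x hxU hx
    rw [← h.chart.left_inv (h.flow_mem_source hxU (Real.logb 2 ‖s x‖)), h.chart_flow hxU,
      Function.comp_apply]
    congr 1
    ext i
    rw [modelFlow_apply, Real.rpow_neg two_pos.le,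
      Real.rpow_logb two_pos (by norm_num) hx]
    by_cases hi : (i : ℕ) < h.index <;> simp [e, s, l, stableProj_apply, hi]
  refine ⟨h.chart.symm w, mem_closure_of_tendsto hflow (hFA.mono fun x hx => hA x hx _),
    h.stable_eq.superset ⟨h.symm_mem_source w, ?_⟩, fun hwq => ?_⟩
  · rwa [mem_preimage, h.chart_symm]
  · have := h.chart_symm w
    rw [hwq, h.chart_self] at this
    simp [← this] at hw1

end HyperbolicChart

theorem Flow.apply_mem_closure (f : Flow ℝ M) {A : Set M} (hA : ∀ x ∈ A, ∀ t, f t x ∈ A) {x : M}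
    (hx : x ∈ closure A) (t : ℝ) : f t x ∈ closure A :=
  map_mem_closure (f.continuous continuous_const continuous_id) hx fun y hy => hA y hy t

section Family

variable {f : Flow ℝ M} {ι : Type*} [PartialOrder ι] {P : ι → M}

theorem HyperbolicChart.mem_closure_of_mem_unstable {p q : M}
    (h : HyperbolicChart n f p) (h' : HyperbolicChart n f q) {x : M}
    (hx : x ∈ closure h.unstable) (hx' : x ∈ h'.unstable) :
    q ∈ closure h.unstable :=
  isClosed_closure.mem_of_tendsto (h'.mem_unstable_iff_tendsto.1 hx')
    (Eventually.of_forall fun _ => f.apply_mem_closure (fun _ hy s => h.flow_mem_unstable hy s) hx _)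

/-- If `P j` is a limit of the unstable manifold of `P i`, then `j ≤ i`. For `j ≠ i` the closure of
the unstable manifold of `P i` contains a point of the stable manifold of `P j` other than `P j`,
and this point comes from some `P j'` with `j < j'`, again in the closure; the induction is downward
on `j`. -/
theorem le_of_mem_closure_unstable [WellFoundedGT ι] (hP : Function.Injective P)
    (h : ∀ i, HyperbolicChart n f (P i)) (hcov : ⋃ i, (h i).unstable = univ)
    (hord : ∀ i j, ((h i).stable ∩ (h j).unstable).Nonempty → i ≤ j) (i j : ι)
    (hj : P j ∈ closure (h i).unstable) : j ≤ i := by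
  induction j using WellFoundedGT.induction with
  | ind j ih =>
    by_cases hij : j = i
    · exact hij.le
    have hd : Disjoint (h i).unstable (h j).unstable :=
      disjoint_left.2 fun x hx hx' => hij (hP ((h j).eq_of_mem_unstable (h i) hx' hx))
    obtain ⟨y, hy, hys, hyj⟩ := (h j).exists_mem_closure_mem_stable
      (fun x hx t => (h i).flow_mem_unstable hx t) hj hd
    obtain ⟨j', hj'⟩ := mem_iUnion.1 (hcov.superset (mem_univ y))
    have hlt : j < j' := by
      refine lt_of_le_of_ne (hord j j' ⟨y, hys, hj'⟩) ?_
      rintro rfl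
      exact hyj ((h j).stable_inter_unstable.subset ⟨hys, hj'⟩)
    exact hlt.le.trans (ih j' hlt ((h i).mem_closure_of_mem_unstable (h j') hy hj'))

theorem closure_unstable_diff_subset [WellFoundedGT ι] (hP : Function.Injective P)
    (h : ∀ i, HyperbolicChart n f (P i)) (hcov : ⋃ i, (h i).unstable = univ)
    (hord : ∀ i j, ((h i).stable ∩ (h j).unstable).Nonempty → i ≤ j) (i : ι) :
    closure (h i).unstable \ ((h i).unstable ∪ {P i}) ⊆ ⋃ j, ⋃ _ : j < i, (h j).unstable := by
  rintro x ⟨hx, hxi⟩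
  obtain ⟨j, hj⟩ := mem_iUnion.1 (hcov.superset (mem_univ x))
  have hle := le_of_mem_closure_unstable hP h hcov hord i j
    ((h i).mem_closure_of_mem_unstable (h j) hx hj)
  refine mem_iUnion₂.2 ⟨j, lt_of_le_of_ne hle ?_, hj⟩
  rintro rfl
  exact hxi (Or.inl hj)

theorem closure_stable_diff_subset [WellFoundedLT ι] (hP : Function.Injective P)
    (h : ∀ i, HyperbolicChart n f (P i)) (hcov : ⋃ i, (h i).stable = univ)
    (hord : ∀ i j, ((h i).stable ∩ (h j).unstable).Nonempty → i ≤ j) (i : ι) :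
    closure (h i).stable \ ((h i).stable ∪ {P i}) ⊆ ⋃ j, ⋃ _ : i < j, (h j).stable := by
  have key := closure_unstable_diff_subset (ι := ιᵒᵈ) (P := fun j => P (OrderDual.ofDual j))
    (fun _ _ hab => hP hab) (fun j => (h (OrderDual.ofDual j)).reverse)
    (by simp only [HyperbolicChart.reverse_unstable]; exact hcov)
    (fun j j' hjj => by
      rw [HyperbolicChart.reverse_unstable, HyperbolicChart.reverse_stable, inter_comm] at hjj
      exact hord _ _ hjj) (OrderDual.toDual i)
  simp only [HyperbolicChart.reverse_unstable] at key
  exact key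

end Family

/-! ### Chain recurrence -/

/-- A single jump of an `ε`-chain: flow for a time at least `1`, then move by less than `ε`. -/
def EpsStep (f : Flow ℝ M) (ε : ℝ) (x y : M) : Prop :=
  ∃ t : ℝ, 1 ≤ t ∧ dist (f t x) y < ε

/-- `y` is reached from `x` by `ε`-chains for every `ε > 0`. -/
def ChainReaches (f : Flow ℝ M) (x y : M) : Prop :=
  ∀ ε : ℝ, 0 < ε → Relation.TransGen (EpsStep f ε) x y

theorem exists_isEpsChain_of_transGen {f : Flow ℝ M} {ε : ℝ} {x y : M}
    (h : Relation.TransGen (EpsStep f ε) x y) : ∃ T, IsEpsChain f ε T x y := by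
  suffices H : ∃ (m : ℕ) (z : ℕ → M) (t : ℕ → ℝ), 1 ≤ m ∧ z 0 = x ∧ z m = y ∧
      ∀ i < m, 1 ≤ t i ∧ dist (f (t i) (z i)) (z (i + 1)) < ε by
    obtain ⟨m, z, t, h1, h2, h3, h4⟩ := H
    exact ⟨_, m, z, t, h1, h2, h3, h4, rfl⟩
  induction h with
  | @single y h =>
    obtain ⟨t, ht, hd⟩ := h
    refine ⟨1, fun i => if i = 0 then x else y, fun _ => t, le_rfl, rfl, rfl, fun i hi => ?_⟩
    obtain rfl : i = 0 := by omega
    exact ⟨ht, hd⟩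
  | @tail _ y _ h ih =>
    obtain ⟨m, z, t, hm, h0, hz, hst⟩ := ih
    obtain ⟨s, hs, hd⟩ := h
    refine ⟨m + 1, Function.update z (m + 1) y, Function.update t m s, by omega, ?_, ?_, ?_⟩
    · rw [Function.update_of_ne (by omega), h0]
    · rw [Function.update_self]
    · intro i hi
      rw [Function.update_of_ne (show i ≠ m + 1 by omega)]
      rcases Nat.lt_succ_iff_lt_or_eq.1 hi with hi | rfl
      · rw [Function.update_of_ne hi.ne, Function.update_of_ne (by omega)]
        exact hst i hi
      · rw [Function.update_self, Function.update_self, hz]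
        exact ⟨hs, hd⟩

namespace ChainReaches

variable {f : Flow ℝ M} {x y z p : M}

theorem mem_chainRecurrentSet (h : ChainReaches f x x) : x ∈ chainRecurrentSet f :=
  fun ε hε => exists_isEpsChain_of_transGen (h ε hε)

theorem trans (h : ChainReaches f x y) (h' : ChainReaches f y z) : ChainReaches f x z :=
  fun ε hε => (h ε hε).trans (h' ε hε)

theorem of_tendsto (h : Tendsto (fun t => f t x) atTop (𝓝 p)) : ChainReaches f x p := by
  intro ε hε
  obtain ⟨t, ht, ht1⟩ :=
    ((h.eventually (Metric.ball_mem_nhds p hε)).and (eventually_ge_atTop 1)).exists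
  exact .single ⟨t, ht1, ht⟩

theorem of_tendsto_neg (hp : ∀ t, f t p = p) (h : Tendsto (fun t => f (-t) x) atTop (𝓝 p)) :
    ChainReaches f p x := by
  intro ε hε
  obtain ⟨t, ht, ht1⟩ :=
    ((h.eventually (Metric.ball_mem_nhds p hε)).and (eventually_ge_atTop 1)).exists
  refine .tail (.single ⟨1, le_rfl, ?_⟩) (b := f (-t) x) ⟨t, ht1, ?_⟩
  · rw [hp, dist_comm]
    exact ht
  · rwa [f.apply_apply_neg, dist_self]

end ChainReaches

/-- A point is chain recurrent if some orbit comes arbitrarily close to it at two times that differ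
by at least `2`: one unit of time is spent at the point before jumping onto the orbit, and at least
one more on the orbit. -/
theorem mem_chainRecurrentSet_of_returns {f : Flow ℝ M} {x y : M}
    (h : ∀ s ∈ 𝓝 y, ∃ a b : ℝ, a + 2 ≤ b ∧ f a x ∈ s ∧ f b x ∈ s) : y ∈ chainRecurrentSet f := by
  refine ChainReaches.mem_chainRecurrentSet fun ε hε => ?_
  have hc : Continuous fun z => f 1 z := f.continuous continuous_const continuous_id
  obtain ⟨a, b, hab, ⟨ha, -⟩, -, hb⟩ := h _ (inter_mem
    (hc.continuousAt.preimage_mem_nhds (Metric.ball_mem_nhds (f 1 y) hε))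
    (Metric.ball_mem_nhds y hε))
  refine .tail (.single ⟨1, le_rfl, ?_⟩) (b := f 1 (f a x)) ⟨b - a - 1, by linarith, ?_⟩
  · rw [dist_comm]
    exact ha
  · rw [← Flow.map_add, ← Flow.map_add]
    rwa [show b - a - 1 + 1 + a = b by ring]

theorem mem_chainRecurrentSet_of_mapClusterPt {f : Flow ℝ M} {x y : M}
    (h : MapClusterPt y atTop fun t => f t x) : y ∈ chainRecurrentSet f := by
  refine mem_chainRecurrentSet_of_returns (x := x) fun s hs => ?_
  have hfr := mapClusterPt_iff_frequently.1 h s hs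
  obtain ⟨a, ha⟩ := hfr.exists
  obtain ⟨b, hb, hab⟩ := (hfr.and_eventually (eventually_ge_atTop (a + 2))).exists
  exact ⟨a, b, hab, ha, hb⟩

theorem mem_chainRecurrentSet_of_mapClusterPt_neg {f : Flow ℝ M} {x y : M}
    (h : MapClusterPt y atTop fun t => f (-t) x) : y ∈ chainRecurrentSet f := by
  refine mem_chainRecurrentSet_of_returns (x := x) fun s hs => ?_
  have hfr := mapClusterPt_iff_frequently.1 h s hs
  obtain ⟨a, ha⟩ := hfr.exists
  obtain ⟨b, hb, hab⟩ := (hfr.and_eventually (eventually_ge_atTop (a + 2))).exists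
  exact ⟨-b, -a, by linarith, hb, ha⟩

/-- A continuous curve in a compact Hausdorff space whose limit points form a finite set converges:
it is eventually in the union of small disjoint neighbourhoods of these points, and by connectedness
in a single one. -/
theorem exists_tendsto_of_finite_mapClusterPt {X : Type*} [TopologicalSpace X] [CompactSpace X]
    [T2Space X] {c : ℝ → X} (hc : Continuous c) {R : Set X} (hR : R.Finite)
    (h : ∀ y, MapClusterPt y atTop c → y ∈ R) : ∃ p ∈ R, Tendsto c atTop (𝓝 p) := by
  obtain ⟨p, hp⟩ : ∃ p, MapClusterPt p atTop c := exists_clusterPt_of_compactSpace _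
  refine ⟨p, h p hp, ?_⟩
  obtain ⟨V, hV, hVd⟩ := hR.t2_separation
  -- The curve eventually enters every open set containing `R`.
  have hev : ∀ W : Set X, IsOpen W → R ⊆ W → ∀ᶠ t in atTop, c t ∈ W := by
    intro W hW hRW
    by_contra hcon
    have hfr : ∃ᶠ t in atTop, c t ∈ Wᶜ := not_eventually.1 hcon
    obtain ⟨y, hyW, hy⟩ := hW.isClosed_compl.isCompact.exists_mapClusterPt_of_frequently hfr
    exact hyW (hRW (h y hy))
  have hpV : ∀ᶠ t in atTop, c t ∈ V p := by
    obtain ⟨T, hT⟩ := eventually_atTop.1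
      (hev (⋃ q ∈ R, V q) (isOpen_biUnion fun q _ => (hV q).2)
        fun q hq => mem_biUnion hq (hV q).1)
    obtain ⟨t₀, ht₀, hTt₀⟩ := ((mapClusterPt_iff_frequently.1 hp _
      ((hV p).2.mem_nhds (hV p).1)).and_eventually (eventually_ge_atTop T)).exists
    have hpre : IsPreconnected (c '' Ici T) := isPreconnected_Ici.image c hc.continuousOn
    have hsub := hpre.subset_left_of_subset_union (u := V p) (v := ⋃ q ∈ R \ {p}, V q) (hV p).2
      (isOpen_biUnion fun q _ => (hV q).2) ?_ ?_ ⟨c t₀, mem_image_of_mem c hTt₀, ht₀⟩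
    · filter_upwards [eventually_ge_atTop T] with t ht using hsub ⟨t, ht, rfl⟩
    · refine disjoint_iUnion₂_right.2 fun q hq => hVd (h p hp) hq.1 fun hpq => hq.2 hpq.symm
    · rintro _ ⟨t, ht, rfl⟩
      obtain ⟨q, hq, hqt⟩ := mem_iUnion₂.1 (hT t ht)
      by_cases hqp : q = p
      · exact Or.inl (hqp ▸ hqt)
      · exact Or.inr (mem_iUnion₂.2 ⟨q, ⟨hq, hqp⟩, hqt⟩)
  intro W hW
  obtain ⟨W', hW'W, hW', hpW'⟩ := mem_nhds_iff.1 hW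
  filter_upwards [hpV, hev (W' ∪ ⋃ q ∈ R \ {p}, V q)
    (hW'.union (isOpen_biUnion fun q _ => (hV q).2)) fun q hq => by
      by_cases hqp : q = p
      · exact Or.inl (hqp ▸ hpW')
      · exact Or.inr (mem_iUnion₂.2 ⟨q, ⟨hq, hqp⟩, (hV q).1⟩)] with t ht ht'
  rcases ht' with ht' | ht'
  · exact hW'W ht'
  · obtain ⟨q, hq, hqt⟩ := mem_iUnion₂.1 ht'
    exact absurd hqt (disjoint_left.1 (hVd (h p hp) hq.1 fun hpq => hq.2 hpq.symm) ht)

section Recurrent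

variable {f : Flow ℝ M} (h : ∀ p : chainRecurrentSet f, HyperbolicChart n f (p : M))

theorem iUnion_stable_eq_univ [CompactSpace M] (hfin : (chainRecurrentSet f).Finite) :
    ⋃ p, (h p).stable = univ := by
  refine eq_univ_of_forall fun x => ?_
  obtain ⟨p, hp, hx⟩ := exists_tendsto_of_finite_mapClusterPt
    (f.continuous continuous_id continuous_const) hfin
    fun y hy => mem_chainRecurrentSet_of_mapClusterPt (x := x) hy
  exact mem_iUnion.2 ⟨⟨p, hp⟩, (h ⟨p, hp⟩).mem_stable_iff_tendsto.2 hx⟩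

theorem iUnion_unstable_eq_univ [CompactSpace M] (hfin : (chainRecurrentSet f).Finite) :
    ⋃ p, (h p).unstable = univ := by
  refine eq_univ_of_forall fun x => ?_
  obtain ⟨p, hp, hx⟩ := exists_tendsto_of_finite_mapClusterPt
    (f.continuous continuous_neg continuous_const) hfin
    fun y hy => mem_chainRecurrentSet_of_mapClusterPt_neg (x := x) hy
  exact mem_iUnion.2 ⟨⟨p, hp⟩, (h ⟨p, hp⟩).mem_unstable_iff_tendsto.2 hx⟩

/-! ### The Smale relation -/

/-- The relation `p ≺ q`: the stable manifold of `p` meets the unstable manifold of `q`. -/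
def SmaleRel (p q : chainRecurrentSet f) : Prop := ((h p).stable ∩ (h q).unstable).Nonempty

variable {h} {p q : chainRecurrentSet f}

theorem SmaleRel.chainReaches (hpq : SmaleRel h p q) : ChainReaches f (q : M) p := by
  obtain ⟨x, hxp, hxq⟩ := hpq
  exact (ChainReaches.of_tendsto_neg (h q).isFixed ((h q).mem_unstable_iff_tendsto.1 hxq)).trans
    (.of_tendsto ((h p).mem_stable_iff_tendsto.1 hxp))

theorem SmaleRel.refl (p : chainRecurrentSet f) : SmaleRel h p p :=
  ⟨p, (h p).self_mem_stable, (h p).self_mem_unstable⟩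

theorem chainReaches_of_reflTransGen (hpq : Relation.ReflTransGen (SmaleRel h) p q) :
    ChainReaches f (q : M) p := by
  induction hpq with
  | refl => exact (SmaleRel.refl (h := h) p).chainReaches
  | tail _ hbc ih => exact hbc.chainReaches.trans ih

/-- A heteroclinic orbit cannot be closed up to a cycle: its points would be chain recurrent, hence
fixed, hence equal to both ends of the orbit. -/
theorem SmaleRel.eq_of_chainReaches (hpq : SmaleRel h p q) (hc : ChainReaches f (p : M) q) :
    p = q := by
  obtain ⟨x, hxp, hxq⟩ := hpq
  have hx : x ∈ chainRecurrentSet f := ChainReaches.mem_chainRecurrentSet <|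
    ((ChainReaches.of_tendsto ((h p).mem_stable_iff_tendsto.1 hxp)).trans hc).trans
      (ChainReaches.of_tendsto_neg (h q).isFixed ((h q).mem_unstable_iff_tendsto.1 hxq))
  have h1 := (h p).eq_of_mem_stable (h ⟨x, hx⟩) hxp (h ⟨x, hx⟩).self_mem_stable
  have h2 := (h q).eq_of_mem_unstable (h ⟨x, hx⟩) hxq (h ⟨x, hx⟩).self_mem_unstable
  exact Subtype.ext (h1.trans h2.symm)

theorem reflTransGen_smaleRel_antisymm (hpq : Relation.ReflTransGen (SmaleRel h) p q)
    (hqp : Relation.ReflTransGen (SmaleRel h) q p) : p = q := by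
  induction hpq with
  | refl => rfl
  | tail hab hbc ih =>
    obtain rfl := hbc.eq_of_chainReaches (chainReaches_of_reflTransGen (hqp.trans hab))
    exact ih hqp

variable (h) in
/-- The type of a fixed point: `0` for sinks, `1` for saddles, `2` for sources. In dimension `0`,
where the index `0` is also the full index, the value is `0`. -/
def typeRank (p : chainRecurrentSet f) : ℕ :=
  if (h p).index = 0 then 0 else if (h p).index < n then 1 else 2

/-- Nothing but itself precedes a sink, and a source precedes nothing but itself, so `≺` is
compatible with the ranks of the types. -/
theorem SmaleRel.typeRank_le (hpq : SmaleRel h p q) : typeRank h p ≤ typeRank h q := by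
  by_cases heq : p = q
  · rw [heq]
  obtain ⟨x, hxp, hxq⟩ := hpq
  have hp : (h p).index ≠ n := by
    intro hn
    rw [(h p).stable_eq_singleton hn, mem_singleton_iff] at hxp
    subst hxp
    exact heq (Subtype.ext ((h p).eq_of_mem_unstable (h q) (h p).self_mem_unstable hxq))
  have hq : (h q).index ≠ 0 := by
    intro h0
    rw [(h q).unstable_eq_singleton h0, mem_singleton_iff] at hxq
    subst hxq
    exact heq (Subtype.ext ((h p).eq_of_mem_stable (h q) hxp (h q).self_mem_stable))
  have := (h p).index_le
  unfold typeRank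
  split_ifs <;> omega

variable (h) in
/-- The order on the fixed points that compares types first and, within a type, is generated by
`≺`. -/
@[reducible]
def smalePartialOrder : PartialOrder (chainRecurrentSet f) where
  le p q := typeRank h p < typeRank h q ∨
    typeRank h p = typeRank h q ∧ Relation.ReflTransGen (SmaleRel h) p q
  le_refl p := Or.inr ⟨rfl, .refl⟩
  le_trans p q r := by
    rintro (h1 | ⟨h1, h1'⟩) (h2 | ⟨h2, h2'⟩)
    · exact Or.inl (h1.trans h2)
    · exact Or.inl (h1.trans_eq h2)
    · exact Or.inl (h1.trans_lt h2)
    · exact Or.inr ⟨h1.trans h2, h1'.trans h2'⟩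
  le_antisymm p q := by
    rintro (h1 | ⟨h1, h1'⟩) (h2 | ⟨h2, h2'⟩)
    · omega
    · omega
    · omega
    · exact reflTransGen_smaleRel_antisymm h1' h2'

theorem exists_equiv_fin_of_partialOrder (α : Type*) [PartialOrder α] [Finite α] :
    ∃ (k : ℕ) (p : Fin k ≃ α), ∀ i j, p i ≤ p j → i ≤ j := by
  let _ : Fintype (LinearExtension α) := Fintype.ofFinite α
  let e := Fintype.orderIsoFinOfCardEq (LinearExtension α) rfl
  let p : Fin (Fintype.card (LinearExtension α)) ≃ α := e.toEquiv
  refine ⟨_, p, fun i j hij => ?_⟩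
  have hle : toLinearExtension (p i) ≤ toLinearExtension (p j) := toLinearExtension.monotone hij
  exact e.le_iff_le.1 hle

variable (h) in
theorem exists_enumeration (hfin : (chainRecurrentSet f).Finite) :
    ∃ (k : ℕ) (p : Fin k ≃ chainRecurrentSet f),
      ExtendsSmaleRelation h p ∧ SinksSaddlesSources h p := by
  let _ : PartialOrder (chainRecurrentSet f) := smalePartialOrder h
  have : Finite (chainRecurrentSet f) := hfin
  obtain ⟨k, p, hmono⟩ := exists_equiv_fin_of_partialOrder (chainRecurrentSet f)
  have hlt : ∀ i j, typeRank h (p i) < typeRank h (p j) → i < j := fun i j hij => by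
    refine lt_of_le_of_ne (hmono i j (Or.inl hij)) ?_
    rintro rfl
    exact lt_irrefl _ hij
  refine ⟨_, p, fun i j hij => hmono i j ?_, fun i j hi hj => hlt i j ?_,
    fun i j hi hj => hlt i j ?_⟩
  · have hij' : SmaleRel h (p i) (p j) := hij
    exact hij'.typeRank_le.lt_or_eq.imp id fun heq => ⟨heq, .single hij'⟩
  · simp only [HyperbolicChart.IsSink, HyperbolicChart.IsSaddle] at hi hj
    unfold typeRank
    split_ifs <;> omega
  · simp only [HyperbolicChart.IsSource, HyperbolicChart.IsSaddle] at hi hj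
    unfold typeRank
    split_ifs <;> omega

end Recurrent

end

theorem theorem2 (n : ℕ) {M : Type*} [MetricSpace M] [CompactSpace M]
    [ChartedSpace (EuclideanSpace ℝ (Fin n)) M] (f : Flow ℝ M) (hf : IsClassG n f)
    (h : ∀ p : chainRecurrentSet f, HyperbolicChart n f (p : M)) :
    (∃ (k : ℕ) (p : Fin k ≃ chainRecurrentSet f),
      ExtendsSmaleRelation h p ∧ SinksSaddlesSources h p) ∧
    ∀ (k : ℕ) (p : Fin k ≃ chainRecurrentSet f), ExtendsSmaleRelation h p →
      ((⋃ i, (h (p i)).unstable) = univ ∧ (⋃ i, (h (p i)).stable) = univ) ∧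
      (∀ i,
        (IsTopSubmanifold n (h (p i)).index (h (p i)).unstable ∧
          Nonempty ((h (p i)).unstable ≃ₜ EuclideanSpace ℝ (Fin (h (p i)).index))) ∧
        (IsTopSubmanifold n (n - (h (p i)).index) (h (p i)).stable ∧
          Nonempty ((h (p i)).stable ≃ₜ EuclideanSpace ℝ (Fin (n - (h (p i)).index))))) ∧
      (∀ i,
        closure (h (p i)).unstable \ ((h (p i)).unstable ∪ {(p i : M)}) ⊆
          (⋃ j : Fin k, ⋃ _ : j < i, (h (p j)).unstable) ∧
        closure (h (p i)).stable \ ((h (p i)).stable ∪ {(p i : M)}) ⊆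
          ⋃ j : Fin k, ⋃ _ : i < j, (h (p j)).stable) := by
  refine ⟨exists_enumeration h hf.1, fun k p hp => ?_⟩
  have hu : ⋃ i, (h (p i)).unstable = univ :=
    (p.surjective.iUnion_comp fun q => (h q).unstable).trans (iUnion_unstable_eq_univ h hf.1)
  have hs : ⋃ i, (h (p i)).stable = univ :=
    (p.surjective.iUnion_comp fun q => (h q).stable).trans (iUnion_stable_eq_univ h hf.1)
  have hinj : Function.Injective fun i => (p i : M) := Subtype.val_injective.comp p.injective
  exact ⟨⟨hu, hs⟩,
    fun i => ⟨⟨(h (p i)).isTopSubmanifold_unstable, (h (p i)).nonempty_unstable_homeomorph⟩,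
      (h (p i)).isTopSubmanifold_stable, (h (p i)).nonempty_stable_homeomorph⟩,
    fun i => ⟨closure_unstable_diff_subset hinj (fun i => h (p i)) hu hp i,
      closure_stable_diff_subset hinj (fun i => h (p i)) hs hp i⟩⟩
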